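/- Let $T$ be a weakly o-minimal theory (every model is a linearly ordered structure in which each subset of the line definable with parameters is a finite union of convex sets), let $M\models T$, let $A\subseteq M$, and let $E$ be an $A$-definable equivalence relation on $M$ all of whose classes are convex. Order $M/E$ by the order induced from $M$, and write $\pi$ also for the coordinatewise quotient map $M^n\to (M/E)^n$. A subset $D$ of $(M/E)^n$ is $A$-definable if $\pi^{-1}(D)$ is $A$-definable. The dimension $\dim S$ of $S\subseteq (M/E)^n$ is the largest $l$ such that the projection of $S$ to some $l$ of the coordinates contains an open box, where an open box is a product of infinite convex sets (if $M/E$ is densely ordered with more than one point, this says that the projection has nonempty interior); $\dim\emptyset=-\infty$. Then for every $n\ge 0$: (1) Let $I_1,\dots,I_n\subseteq M$ be convex sets such that each $I_j/E$ is infinite, let $B=I_1\times\cdots\times I_n$, and let $X\subseteq B$ be definable (with parameters from $M$). If $\pi(X)=\pi(B)$, then $\dim(\pi(B\setminus X))<n$. (2) Suppose that $M/E$ is infinite, and let $p$ be a complete type over $A$ on $(M/E)^n$ that is generic, i.e. the least dimension of an $A$-definable set in $p$ equals $\dim (M/E)^n$. Then the partial type $\pi^{-1}(p)=\{\pi^{-1}(D):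 D\in p\}$ on $M^n$ is a complete type over $A$: it is consistent, and for every $A$-definable $Y\subseteq M^n$ it implies $Y$ or it implies $M^n\setminus Y$. -/

import Mathlib

universe u v w

/-- A weakly o-minimal structure: a linearly ordered structure in which every subset of the line
that is definable with parameters is a finite union of convex sets. -/
def IsWeaklyOMinimal (L : FirstOrder.Language.{u, v}) (N : Type w) [L.Structure N]
    [LinearOrder N] : Prop :=
  ∀ S : Set N, (Set.univ : Set N).Definable₁ L S →
    ∃ F : Set (Set N), F.Finite ∧ (∀ C ∈ F, C.OrdConnected) ∧ S = ⋃₀ F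

/-- A weakly o-minimal theory: every model is a weakly o-minimal structure, linearly ordered by
the order symbol of the language. -/
def IsWeaklyOMinimalTheory {L : FirstOrder.Language.{u, v}} [L.IsOrdered] (T : L.Theory) : Prop :=
  ∀ (N : Type w) [L.Structure N] [N ⊨ T],
    ∃ _ : LinearOrder N, L.OrderedStructure N ∧ IsWeaklyOMinimal L N

/-- The subsets of `M ^ n` definable over `A`. -/
def definableSets (L : FirstOrder.Language.{u, v}) {M : Type w} [L.Structure M] (A : Set M) (n : ℕ) :
    Set (Set (Fin n → M)) :=
  {Y | A.Definable L Y}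

/-- A convex equivalence relation on a linear order: all its classes are convex. -/
structure ConvexEquiv (M : Type w) [LinearOrder M] extends Setoid M where
  ordConnected_class : ∀ a : M, {b : M | r a b}.OrdConnected

namespace ConvexEquiv

variable {M : Type w} [LinearOrder M]

/-- The equivalence relation as a set of pairs. -/
def graph (E : ConvexEquiv M) : Set (M × M) := {x | E.r x.1 x.2}

/-- The quotient `M/E`. -/
def Quot (E : ConvexEquiv M) : Type w := Quotient E.toSetoid

/-- The class of an element. -/
def cls (E : ConvexEquiv M) (a : M) : E.Quot := Quotient.mk E.toSetoid a

theorem cls_eq_cls (E : ConvexEquiv M) {a b : M} : E.cls a = E.cls b ↔ E.r a b :=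
  Quotient.eq (r := E.toSetoid)

theorem exists_cls (E : ConvexEquiv M) (α : E.Quot) : ∃ a, E.cls a = α :=
  Quotient.exists_rep α

/-- Two classes that interleave are equal, since classes are convex. -/
theorem cls_eq_of_le_of_le (E : ConvexEquiv M) {a b a' b' : M} (haa' : E.cls a = E.cls a')
    (hbb' : E.cls b = E.cls b') (h : a ≤ b) (h' : b' ≤ a') : E.cls a = E.cls b := by
  have ha : E.r a a' := E.cls_eq_cls.1 haa'
  have hb : E.r b b' := E.cls_eq_cls.1 hbb'
  rcases le_total b a' with hba | hba
  · exact E.cls_eq_cls.2 ((E.ordConnected_class a).out (E.iseqv.refl a) ha ⟨h, hba⟩)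
  · have : E.r b a' := (E.ordConnected_class b).out hb (E.iseqv.refl b) ⟨h', hba⟩
    exact haa'.trans (E.cls_eq_cls.2 this).symm

/-- The order of `M/E` induced by the order of `M`. -/
noncomputable instance (E : ConvexEquiv M) : LinearOrder E.Quot where
  le α β := ∃ a b, E.cls a = α ∧ E.cls b = β ∧ a ≤ b
  le_refl α := by
    obtain ⟨a, rfl⟩ := E.exists_cls α
    exact ⟨a, a, rfl, rfl, le_rfl⟩
  le_trans α β γ := by
    rintro ⟨a, b, rfl, rfl, hab⟩ ⟨b', c, hb, rfl, hbc⟩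
    rcases le_total a c with hac | hca
    · exact ⟨a, c, rfl, rfl, hac⟩
    · rcases le_total b c with hb_c | hcb
      · exact ⟨a, c, rfl, rfl, hab.trans hb_c⟩
      · have h : E.cls b' = E.cls c := E.cls_eq_of_le_of_le hb rfl hbc hcb
        exact ⟨a, b, rfl, hb.symm.trans h, hab⟩
  le_antisymm α β := by
    rintro ⟨a, b, rfl, rfl, hab⟩ ⟨b', a', hb, ha, hba⟩
    exact E.cls_eq_of_le_of_le ha.symm hb.symm hab hba
  le_total α β := by
    obtain ⟨a, rfl⟩ := E.exists_cls α
    obtain ⟨b, rfl⟩ := E.exists_cls β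
    exact (le_total a b).imp (fun h => ⟨a, b, rfl, rfl, h⟩) (fun h => ⟨b, a, rfl, rfl, h⟩)
  toDecidableLE := Classical.decRel _

/-- The quotient map `π : M ^ n → (M/E) ^ n`. -/
def proj (E : ConvexEquiv M) (n : ℕ) (x : Fin n → M) : Fin n → E.Quot := fun i => E.cls (x i)

/-- The subsets of `(M/E) ^ n` definable over `A`: those whose preimage in `M ^ n` is definable
over `A`. -/
def definableQuotSets (E : ConvexEquiv M) (L : FirstOrder.Language.{u, v}) [L.Structure M]
    (A : Set M) (n : ℕ) : Set (Set (Fin n → E.Quot)) :=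
  {D | A.Definable L (E.proj n ⁻¹' D)}

end ConvexEquiv

section Dimension

variable {Q : Type w} [LinearOrder Q]

/-- `S` contains a cartesian product of infinite convex sets. In a dense linear order this says
that `S` has nonempty interior; in general it keeps finite sets from counting as open boxes. -/
def ContainsBox {ι : Type*} (S : Set (ι → Q)) : Prop :=
  ∃ J : ι → Set Q, (∀ i, (J i).OrdConnected ∧ (J i).Infinite) ∧ Set.univ.pi J ⊆ S

open Classical in
/-- The dimension of `S ⊆ Q ^ n`: the largest `l` such that the projection of `S` to some `l` of
the coordinates contains an open box. It is `⊥` for the empty set. -/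
noncomputable def orderDim {n : ℕ} (S : Set (Fin n → Q)) : WithBot ℕ :=
  (Finset.univ.filter (fun s : Finset (Fin n) =>
    ContainsBox ((fun (x : Fin n → Q) (i : s) => x i) '' S))).sup
      (fun s => (s.card : WithBot ℕ))

/-- `p` is generic in `X`: it contains `X`, and the least dimension of a member of `p` is that
of `X`. -/
def IsGenericIn {n : ℕ} (p : Set (Set (Fin n → Q))) (X : Set (Fin n → Q)) : Prop :=
  X ∈ p ∧ IsLeast (orderDim '' p) (orderDim X)

end Dimension

section Types

variable {X : Type w}

/-- A complete type, where `𝒟` is the Boolean algebra of subsets of `X` definable over the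
parameters (a formula over the parameters is identified with the set it defines): a finitely
satisfiable set of members of `𝒟` that decides every member of `𝒟`. -/
structure IsCompleteType (𝒟 p : Set (Set X)) : Prop where
  subset : p ⊆ 𝒟
  finitely_satisfiable : ∀ F : Finset (Set X), ↑F ⊆ p → (⋂₀ (F : Set (Set X))).Nonempty
  complete : ∀ D ∈ 𝒟, D ∈ p ∨ Dᶜ ∈ p

/-- The partial type `q` implies `Y`; by compactness this is the same as: every realization of
`q` in every elementary extension satisfies the formula defining `Y`. -/
def Entails (q : Set (Set X)) (Y : Set X) : Prop :=
  ∃ F : Finset (Set X), ↑F ⊆ q ∧ ⋂₀ (F : Set (Set X)) ⊆ Y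

/-- The set of all consequences of the partial type `q` among the sets in `𝒟`. The partial type
`q` is complete when this set is a complete type. -/
def consequences (𝒟 q : Set (Set X)) : Set (Set X) := {Y | Y ∈ 𝒟 ∧ Entails q Y}

/-- The pullback of a partial type along a map. -/
def pullbackType {X' : Type w} (f : X' → X) (p : Set (Set X)) : Set (Set X') :=
  (fun D => f ⁻¹' D) '' p

end Types

/-! ### Bounded alternation of definable subsets of the line -/

open FirstOrder FirstOrder.Language

/-! Say that `Y ⊆ M^n` splits a tuple of classes when both `Y` and its complement meet the preimage
of the tuple. Both claims follow from `not_containsBox_splits`: the tuples split by a definable set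
contain no open box. In (1), `X` splits every tuple in `π(B \ X)`. In (2), a type `p` that does not
decide `Y` contains `π(Y) ∩ π(Yᶜ)`, the set of split tuples, while every member of a generic type
contains a box.

The lemma is proved by counting. In a grid `G^n` only `O(|G|^(n-1))` tuples are split, uniformly in
definable families (`exists_card_splits_bound`), whereas a box with `N` classes chosen on each side
yields `N^n` split tuples with `|G| ≤ nN`. The count is an induction on `n`: `Splits.cons_cases`
separates off one coordinate, and uniform finiteness, obtained from an ultraproduct, bounds the
splitting in that coordinate. -/

theorem false_of_alternating {N : Type*} [LinearOrder N] {F : Set (Set N)} (hF : F.Finite)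
    (hC : ∀ C ∈ F, C.OrdConnected) {a : ℕ → N} (ha : ∀ i j, i < j → a i ≤ a j)
    (h : ∀ i, a i ∈ ⋃₀ F ↔ Even i) : False := by
  have hmem : ∀ i : ℕ, ∃ C ∈ F, a (2 * i) ∈ C := fun i => (h (2 * i)).2 (even_two_mul i)
  choose C hCF haC using hmem
  -- Two even-indexed points share a convex piece, which then swallows an odd-indexed point between
  -- them.
  obtain ⟨i, j, hij, hCij⟩ : ∃ i j, i < j ∧ C i = C j := by
    obtain ⟨i, -, j, -, hne, heq⟩ :=
      Set.infinite_univ.exists_ne_map_eq_of_mapsTo (fun i _ => hCF i) hF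
    rcases lt_or_gt_of_ne hne with hlt | hlt
    · exact ⟨i, j, hlt, heq⟩
    · exact ⟨j, i, hlt, heq.symm⟩
  have hmid : a (2 * i + 1) ∈ C i :=
    (hC _ (hCF i)).out (haC i) (hCij ▸ haC j) ⟨ha _ _ (by omega), ha _ _ (by omega)⟩
  have := (h (2 * i + 1)).1 ⟨C i, hCF i, hmid⟩
  rw [Nat.even_iff] at this
  omega

section Uniform

variable {L : FirstOrder.Language.{u, v}}

theorem IsWeaklyOMinimal.false_of_alternating_formula {N : Type w} [L.Structure N]
    [LinearOrder N] (hN : IsWeaklyOMinimal L N) {β : Type*} (φ : L.Formula (Option β))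
    (t : β → N) {a : ℕ → N} (ha : ∀ i j, i < j → a i ≤ a j)
    (h : ∀ i, φ.Realize (fun o => o.elim (a i) t) ↔ Even i) : False := by
  obtain ⟨F, hF, hC, hS⟩ := hN {x | φ.Realize (fun o => o.elim x t)} (by
    refine Set.definable_iff_exists_formula_sum.2
      ⟨φ.relabel (fun o => o.elim (Sum.inr 0) fun g => Sum.inl ⟨t g, trivial⟩), ?_⟩
    ext x
    simp only [Set.mem_ofPred_eq, Formula.realize_relabel]
    apply iff_of_eq
    congr 1
    ext o
    cases o <;> rfl)
  refine false_of_alternating hF hC ha fun i => ?_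
  rw [← hS]
  exact h i

variable [L.IsOrdered]

/-- Uniform finiteness: the fibres of a definable family of subsets of the line alternate
boundedly often. -/
theorem IsWeaklyOMinimalTheory.exists_alternation_bound {T : L.Theory}
    (hT : IsWeaklyOMinimalTheory.{u, v, w} T)
    (M : Type w) [LinearOrder M] [L.Structure M] [L.OrderedStructure M] [M ⊨ T]
    {β : Type*} (φ : L.Formula (Option β)) :
    ∃ K : ℕ, ∀ (t : β → M) (a : ℕ → M), (∀ i j, i < j → j < K → a i ≤ a j) →
      ¬ ∀ i < K, (φ.Realize (fun o => o.elim (a i) t) ↔ Even i) := by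
  by_contra! hcon
  choose t a ha h using hcon
  have : Nonempty M := ⟨a 0 0⟩
  let U : Ultrafilter ℕ := Filter.hyperfilter ℕ
  let N := (U : Filter ℕ).Product (fun _ : ℕ => M)
  have : N ⊨ T := ⟨fun ψ hψ => (Ultraproduct.sentence_realize ψ).2
    (Filter.Eventually.of_forall fun _ => Theory.realize_sentence_of_mem T hψ)⟩
  obtain ⟨_, hord, hN⟩ := hT N
  -- The `k`-th counterexample controls only indices below `k`; each fixed index is therefore
  -- controlled for almost all `k`.
  have hU : ∀ k : ℕ, ∀ᶠ i in (U : Filter ℕ), k < i := fun k =>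
    (Filter.eventually_gt_atTop k).filter_mono (Nat.hyperfilter_le_atTop)
  let tN : β → N := fun g => ((fun k => t k g : ℕ → M) : (U : Filter ℕ).Product fun _ : ℕ => M)
  let aN : ℕ → N := fun i => ((fun k => a k i : ℕ → M) : (U : Filter ℕ).Product fun _ : ℕ => M)
  refine hN.false_of_alternating_formula φ tN (a := aN) ?_ ?_
  · intro i j hij
    -- The order on `N` supplied by `hT` is known only through the order symbol, so comparisons pass
    -- through Łoś for this atomic formula.
    let le : L.Formula (Fin 2) := (leSymb : L.Relations 2).formula₂ (Term.var 0) (Term.var 1)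
    have key := Ultraproduct.realize_formula_cast (u := U) le
      (x := ![fun k => a k i, fun k => a k j])
    have h1 : ∀ᶠ k in (U : Filter ℕ), le.Realize fun o =>
        (![fun k => a k i, fun k => a k j] : Fin 2 → ℕ → M) o k := by
      filter_upwards [hU j] with k hk
      simpa [le, Formula.realize_rel₂] using ha k i j hij hk
    have h2 := key.2 h1
    simp [le, Formula.realize_rel₂] at h2
    exact (hord.relMap_leSymb ![aN i, aN j]).1 h2
  · intro i
    have key := Ultraproduct.realize_formula_cast (u := U) φ
      (x := fun o => o.elim (fun k => a k i) (fun g k => t k g))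
    have e : (fun o : Option β => ((o.elim (fun k => a k i) (fun g k => t k g) : ℕ → M) :
        (U : Filter ℕ).Product fun _ : ℕ => M)) = fun o => o.elim (aN i) tN := by
      ext o; cases o <;> rfl
    refine (iff_of_eq (congrArg φ.Realize e.symm)).trans (key.trans ?_)
    have : ∀ᶠ k in (U : Filter ℕ), (φ.Realize (fun o : Option β =>
        (o.elim (fun k => a k i) (fun g k => t k g) : ℕ → M) k) ↔ Even i) := by
      filter_upwards [hU i] with k hk
      rw [← h k i hk]
      apply iff_of_eq
      congr 1
      ext o; cases o <;> rfl
    rw [Filter.eventually_congr this]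
    exact Filter.eventually_const

/-- Uniform finiteness for a family definable with parameters. -/
theorem IsWeaklyOMinimalTheory.exists_alternation_bound_of_definable {T : L.Theory}
    (hT : IsWeaklyOMinimalTheory.{u, v, w} T)
    (M : Type w) [LinearOrder M] [L.Structure M] [L.OrderedStructure M] [M ⊨ T]
    {β : Type*} {A : Set M} {W : Set (Option β → M)} (hW : A.Definable L W) :
    ∃ K : ℕ, ∀ (t : β → M) (a : ℕ → M), (∀ i j, i < j → j < K → a i ≤ a j) →
      ¬ ∀ i < K, ((fun o => o.elim (a i) t) ∈ W ↔ Even i) := by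
  obtain ⟨φ, rfl⟩ := Set.definable_iff_exists_formula_sum.1 hW
  -- The parameters from `A` become further free variables.
  obtain ⟨K, hK⟩ := hT.exists_alternation_bound M (φ.relabel
    (Sum.elim (fun c => some (Sum.inl c)) fun o => o.map Sum.inr : _ → Option (A ⊕ β)))
  refine ⟨K, fun t a ha h => hK (Sum.elim (↑) t) a ha fun i hi => ?_⟩
  rw [← h i hi, Formula.realize_relabel]
  apply iff_of_eq
  simp only [Set.mem_ofPred_eq]
  congr 1
  ext o
  rcases o with c | _ | g <;> rfl

end Uniform

/-! ### Classes split by a set -/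

namespace ConvexEquiv

variable {M : Type w} [LinearOrder M] (E : ConvexEquiv M)

theorem cls_le_cls {a b : M} (h : a ≤ b) : E.cls a ≤ E.cls b := ⟨a, b, rfl, rfl, h⟩

theorem lt_of_cls_lt {a b : M} (h : E.cls a < E.cls b) : a < b :=
  lt_of_not_ge fun hba => (E.cls_le_cls hba).not_gt h

/-- `Y` splits the class `d` if both `Y` and its complement meet `d`. -/
def SplitsClass (Y : Set M) (d : E.Quot) : Prop :=
  (∃ x ∈ Y, E.cls x = d) ∧ ∃ x ∉ Y, E.cls x = d

/-- `Y` splits the tuple of classes `c` if both `Y` and its complement meet `π⁻¹(c)`. -/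
def Splits {n : ℕ} (Y : Set (Fin n → M)) (c : Fin n → E.Quot) : Prop :=
  (∃ x ∈ Y, E.proj n x = c) ∧ ∃ x ∉ Y, E.proj n x = c

/-- A set with few alternations splits few classes. -/
theorem card_le_of_splitsClass {Y : Set M} {K : ℕ}
    (hY : ∀ a : ℕ → M, (∀ i j, i < j → j < K → a i ≤ a j) → ¬ ∀ i < K, (a i ∈ Y ↔ Even i))
    (G : Finset E.Quot) (hG : ∀ d ∈ G, E.SplitsClass Y d) : G.card ≤ K := by
  by_contra! hlt
  let e := G.orderEmbOfFin rfl
  -- Along the increasing list of split classes, points can be picked alternately in and out of `Y`.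
  have hp : ∀ i : Fin G.card, ∃ x, E.cls x = e i ∧ (x ∈ Y ↔ Even (i : ℕ)) := by
    intro i
    obtain ⟨⟨x, hx, hxe⟩, y, hy, hye⟩ := hG (e i) (G.orderEmbOfFin_mem rfl i)
    by_cases h : Even (i : ℕ)
    · exact ⟨x, hxe, iff_of_true hx h⟩
    · exact ⟨y, hye, iff_of_false hy h⟩
  choose p hpe hpY using hp
  have hb : ∀ i, min i K < G.card := fun i => (min_le_right i K).trans_lt hlt
  refine hY (fun i => p ⟨min i K, hb i⟩) (fun i j hij hj => ?_) fun i hi => ?_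
  · refine (E.lt_of_cls_lt ?_).le
    rw [hpe, hpe]
    refine e.strictMono ?_
    simp only [Fin.mk_lt_mk]
    omega
  · rw [hpY]
    simp [hi.le]

/-- If `Y` splits `c`, then one of the following holds, where `d` is the class of `b` and the first
coordinate of `c`: the fibre of `Y` over `b` splits the rest of `c`; the set of those `a` whose
fibre splits `d` splits the rest of `c`; this set contains the preimage of the rest of `c`. -/
theorem Splits.cons_cases {n : ℕ} {Y : Set (Fin (n + 1) → M)} {c : Fin (n + 1) → E.Quot}
    (h : E.Splits Y c) {b : M} (hb : E.cls b = c 0) :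
    E.Splits {a : Fin n → M | (Fin.cons b a : Fin (n + 1) → M) ∈ Y} (Fin.tail c) ∨
    E.Splits {a : Fin n → M | E.SplitsClass {x | (Fin.cons x a : Fin (n + 1) → M) ∈ Y} (c 0)}
      (Fin.tail c) ∨
    ∀ a : Fin n → M, E.proj n a = Fin.tail c →
      E.SplitsClass {x | (Fin.cons x a : Fin (n + 1) → M) ∈ Y} (c 0) := by
  obtain ⟨⟨x, hxY, hx⟩, y, hyY, hy⟩ := h
  by_cases h3 : ∀ a : Fin n → M, E.proj n a = Fin.tail c →
      E.SplitsClass {x | (Fin.cons x a : Fin (n + 1) → M) ∈ Y} (c 0)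
  · exact .inr (.inr h3)
  push Not at h3
  obtain ⟨a₁, ha₁, hn₁⟩ := h3
  by_cases h2 : ∃ a : Fin n → M, E.proj n a = Fin.tail c ∧
      E.SplitsClass {x | (Fin.cons x a : Fin (n + 1) → M) ∈ Y} (c 0)
  · obtain ⟨a₂, ha₂, hs₂⟩ := h2
    exact .inr (.inl ⟨⟨a₂, hs₂, ha₂⟩, a₁, hn₁, ha₁⟩)
  push Not at h2
  have htail : ∀ z : Fin (n + 1) → M, E.proj (n + 1) z = c →
      E.proj n (Fin.tail z) = Fin.tail c := fun z hz => by subst hz; rfl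
  have hhead : ∀ z : Fin (n + 1) → M, E.proj (n + 1) z = c → E.cls (z 0) = c 0 :=
    fun z hz => by subst hz; rfl
  -- No fibre over the rest of `c` splits the first class, so replacing the first coordinate by `b`
  -- preserves membership in `Y`.
  refine .inl ⟨⟨Fin.tail x, ?_, htail x hx⟩, Fin.tail y, ?_, htail y hy⟩
  · by_contra hcon
    exact h2 _ (htail x hx) ⟨⟨x 0, by simpa using hxY, hhead x hx⟩, b, hcon, hb⟩
  · intro hcon
    exact h2 _ (htail y hy) ⟨⟨b, hcon, hb⟩, y 0, by simpa using hyY, hhead y hy⟩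

end ConvexEquiv

/-! ### Definability of splitting and saturation -/

section Definability

variable {L : FirstOrder.Language.{u, v}} {M : Type w} [LinearOrder M] [L.Structure M]
  {A : Set M} {E : ConvexEquiv M}

theorem ConvexEquiv.definable_r (hE : A.Definable₂ L E.graph) {α : Type*} (i j : α) :
    A.Definable L {v : α → M | E.r (v i) (v j)} :=
  Set.Definable.preimage_comp ![i, j] hE

/-- The family of sets `{a | the fibre over a splits the class of e}` is definable. -/
theorem ConvexEquiv.definable_splitsClass (hE : A.Definable₂ L E.graph) {α : Type*} {n : ℕ}
    {X : Set (α ⊕ Fin (n + 1) → M)} (hX : A.Definable L X) :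
    A.Definable L {v : Option α ⊕ Fin n → M | E.SplitsClass
      {x | Sum.elim (fun g => v (.inl (some g)))
        (Fin.cons x fun i => v (.inr i) : Fin (n + 1) → M) ∈ X} (E.cls (v (.inl none)))} := by
  -- The two new variables are the witnesses inside and outside the fibre; `f k` uses the `k`-th as
  -- first coordinate.
  let f : Fin 2 → α ⊕ Fin (n + 1) → (Option α ⊕ Fin n) ⊕ Fin 2 := fun k =>
    Sum.elim (fun g => .inl (.inl (some g))) (Fin.cons (.inr k) fun i => .inl (.inr i))
  have h := ((((hX.preimage_comp (f 0)).inter (ConvexEquiv.definable_r hE (.inr 0)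
    (.inl (.inl none)))).inter ((hX.preimage_comp (f 1)).compl.inter
      (ConvexEquiv.definable_r hE (.inr 1) (.inl (.inl none)))))).exists_of_finite
  convert h using 1
  have hf : ∀ (v : Option α ⊕ Fin n → M) (y : Fin 2 → M) (k : Fin 2),
      Sum.elim v y ∘ f k = Sum.elim (fun g => v (.inl (some g)))
        (Fin.cons (y k) fun i => v (.inr i) : Fin (n + 1) → M) := by
    intro v y k
    ext o
    rcases o with g | i
    · rfl
    · refine Fin.cases ?_ (fun i => ?_) i <;> rfl
  ext v
  simp only [ConvexEquiv.SplitsClass, E.cls_eq_cls, Set.mem_ofPred_eq, Set.mem_inter_iff,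
    Set.mem_preimage, Set.mem_compl_iff, hf, Sum.elim_inl, Sum.elim_inr]
  constructor
  · rintro ⟨⟨x, hx, hxe⟩, y, hy, hye⟩
    exact ⟨![x, y], ⟨hx, hxe⟩, hy, hye⟩
  · rintro ⟨y, ⟨hx, hxe⟩, hy, hye⟩
    exact ⟨⟨y 0, hx, hxe⟩, y 1, hy, hye⟩

/-- The saturation is `π⁻¹(π(Y))`, so this makes `π(Y)` definable in the quotient. -/
theorem ConvexEquiv.definable_saturation (hE : A.Definable₂ L E.graph) {n : ℕ}
    {Y : Set (Fin n → M)} (hY : A.Definable L Y) :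
    A.Definable L {x : Fin n → M | ∃ y ∈ Y, E.proj n y = E.proj n x} := by
  have h := ((hY.preimage_comp (Sum.inr : Fin n → Fin n ⊕ Fin n)).inter
    (Set.definable_iInter_of_finite fun i : Fin n =>
      ConvexEquiv.definable_r hE (.inr i) (.inl i : Fin n ⊕ Fin n))).exists_of_finite
  convert h using 1
  ext x
  simp [ConvexEquiv.proj, funext_iff, E.cls_eq_cls]

end Definability

/-! ### Counting tuples in a grid -/

section Counting

open Finset

variable {Q : Type*} [DecidableEq Q] {n : ℕ}

/-- Summing over the first coordinate costs a factor `#G`. Keeping `#G` on the left avoids the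
exponent `n - 1` in the bounds. -/
theorem Finset.card_mul_card_le_of_head (G : Finset Q) (S : Finset (Fin (n + 1) → Q))
    (hS : ∀ c ∈ S, c 0 ∈ G) {B : ℕ}
    (h : ∀ d ∈ G, ∀ S' : Finset (Fin n → Q),
      (∀ c ∈ S', (Fin.cons d c : Fin (n + 1) → Q) ∈ S) → #S' * #G ≤ B) :
    #S * #G ≤ B * #G := by
  have hmaps : Set.MapsTo (fun c : Fin (n + 1) → Q => c 0) S G := hS
  rw [Finset.card_eq_sum_card_fiberwise hmaps, Finset.sum_mul,
    mul_comm B, ← smul_eq_mul (#G) B]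
  refine Finset.sum_le_card_nsmul _ _ _ fun d hd => ?_
  have hinj : Set.InjOn (Fin.tail : (Fin (n + 1) → Q) → Fin n → Q)
      (S.filter fun c => c 0 = d : Finset (Fin (n + 1) → Q)) := by
    intro c hc c' hc' hcc
    simp only [coe_filter, Set.mem_ofPred_eq] at hc hc'
    rw [← Fin.cons_self_tail c, ← Fin.cons_self_tail c', hc.2, hc'.2, hcc]
  rw [← Finset.card_image_of_injOn hinj]
  refine h d hd _ fun c hc => ?_
  obtain ⟨c', hc', rfl⟩ := Finset.mem_image.1 hc
  obtain ⟨hc', rfl⟩ := Finset.mem_filter.1 hc'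
  rwa [Fin.cons_self_tail]

theorem Finset.card_le_of_tail (G : Finset Q) (S : Finset (Fin (n + 1) → Q))
    (hS : ∀ c ∈ S, ∀ i, c i ∈ G) {B : ℕ}
    (h : ∀ (c : Fin n → Q) (S' : Finset Q),
      (∀ d ∈ S', (Fin.cons d c : Fin (n + 1) → Q) ∈ S) → #S' ≤ B) :
    #S ≤ B * #G ^ n := by
  have hmaps : ∀ c ∈ S, Fin.tail c ∈ Fintype.piFinset fun _ : Fin n => G := fun c hc =>
    Fintype.mem_piFinset.2 fun i => hS c hc i.succ
  have := Finset.card_le_mul_card_image_of_maps_to hmaps B fun c _ => ?_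
  · simpa [Fintype.card_piFinset] using this
  · have hinj : Set.InjOn (fun c : Fin (n + 1) → Q => c 0)
        (S.filter fun c' => Fin.tail c' = c : Finset (Fin (n + 1) → Q)) := by
      intro c₁ hc₁ c₂ hc₂ hcc
      simp only [coe_filter, Set.mem_ofPred_eq] at hc₁ hc₂
      rw [← Fin.cons_self_tail c₁, ← Fin.cons_self_tail c₂, hc₁.2, hc₂.2]
      exact congrArg (fun d => (Fin.cons d c : Fin (n + 1) → Q)) hcc
    rw [← Finset.card_image_of_injOn hinj]
    refine h c _ fun d hd => ?_
    obtain ⟨c', hc', rfl⟩ := Finset.mem_image.1 hd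
    obtain ⟨hc', rfl⟩ := Finset.mem_filter.1 hc'
    rwa [Fin.cons_self_tail]

end Counting

/-! ### Few tuples are split -/

section Main

open Finset

variable {L : FirstOrder.Language.{u, v}} [L.IsOrdered] {T : L.Theory}

/-- In a definable family of subsets of `M ^ n`, the number of tuples of classes in a grid `G ^ n`
that are split by a member of the family is `O(|G| ^ (n - 1))`. -/
theorem IsWeaklyOMinimalTheory.exists_card_splits_bound
    (hT : IsWeaklyOMinimalTheory.{u, v, w} T)
    {M : Type w} [LinearOrder M] [L.Structure M] [L.OrderedStructure M] [M ⊨ T]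
    {A : Set M} {E : ConvexEquiv M} (hE : A.Definable₂ L E.graph) (n : ℕ) :
    ∀ {α : Type} {X : Set (α ⊕ Fin n → M)}, A.Definable L X →
      ∃ C : ℕ, ∀ (t : α → M) (G : Finset E.Quot) (S : Finset (Fin n → E.Quot)),
        (∀ c ∈ S, (∀ i, c i ∈ G) ∧ E.Splits {x | Sum.elim t x ∈ X} c) →
        #S * #G ≤ C * #G ^ n := by
  classical
  induction n with
  | zero =>
    intro α X _
    refine ⟨0, fun t G S hS => ?_⟩
    have : S = ∅ := Finset.eq_empty_of_forall_notMem fun c hc => by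
      obtain ⟨x, hx, -⟩ := (hS c hc).2.1
      obtain ⟨y, hy, -⟩ := (hS c hc).2.2
      exact hy (Subsingleton.elim x y ▸ hx)
    simp [this]
  | succ n ih =>
    intro α X hX
    -- `f` turns the first coordinate into a parameter, which is why the induction ranges over all
    -- `α`; `g` makes it the variable on the line.
    let f : α ⊕ Fin (n + 1) → Option α ⊕ Fin n :=
      Sum.elim (fun g => .inl (some g)) (Fin.cons (.inl none) .inr)
    let g : α ⊕ Fin (n + 1) → Option (α ⊕ Fin n) :=
      Sum.elim (fun g => some (.inl g)) (Fin.cons none fun i => some (.inr i))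
    obtain ⟨C₁, hC₁⟩ := ih (hX.preimage_comp f)
    obtain ⟨C₂, hC₂⟩ := ih (ConvexEquiv.definable_splitsClass hE hX)
    obtain ⟨K, hK⟩ := hT.exists_alternation_bound_of_definable M (hX.preimage_comp g)
    have hf : ∀ (t : α → M) (b : M) (a : Fin n → M),
        Sum.elim (fun o : Option α => o.elim b t) a ∘ f =
          Sum.elim t (Fin.cons b a : Fin (n + 1) → M) := by
      intro t b a
      ext o
      rcases o with g | i
      · rfl
      · refine Fin.cases ?_ (fun i => ?_) i <;> rfl
    have hg : ∀ (t : α → M) (b : M) (a : Fin n → M),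
        (fun o : Option (α ⊕ Fin n) => o.elim b (Sum.elim t a)) ∘ g =
          Sum.elim t (Fin.cons b a : Fin (n + 1) → M) := by
      intro t b a
      ext o
      rcases o with g | i
      · rfl
      · refine Fin.cases ?_ (fun i => ?_) i <;> rfl
    refine ⟨C₁ + C₂ + K, fun t G S hS => ?_⟩
    let Y : Set (Fin (n + 1) → M) := {x | Sum.elim t x ∈ X}
    choose r hr using E.exists_cls
    -- The three cases of `Splits.cons_cases`: `P₁` and `P₂` are counted by induction for each head,
    -- `P₃` by alternation for each tail.
    let P₁ : (Fin (n + 1) → E.Quot) → Prop := fun c =>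
      E.Splits {a : Fin n → M | (Fin.cons (r (c 0)) a : Fin (n + 1) → M) ∈ Y} (Fin.tail c)
    let P₂ : (Fin (n + 1) → E.Quot) → Prop := fun c =>
      E.Splits {a : Fin n → M | E.SplitsClass {x | (Fin.cons x a : Fin (n + 1) → M) ∈ Y} (c 0)}
        (Fin.tail c)
    let P₃ : (Fin (n + 1) → E.Quot) → Prop := fun c =>
      ∀ a : Fin n → M, E.proj n a = Fin.tail c →
        E.SplitsClass {x | (Fin.cons x a : Fin (n + 1) → M) ∈ Y} (c 0)
    have hcover : S ⊆ S.filter P₁ ∪ S.filter P₂ ∪ S.filter P₃ := by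
      intro c hc
      have := (hS c hc).2.cons_cases E (hr (c 0))
      simp only [Finset.mem_union, Finset.mem_filter, or_assoc]
      exact this.imp (fun h => ⟨hc, h⟩) (Or.imp (fun h => ⟨hc, h⟩) fun h => ⟨hc, h⟩)
    have h₁ : #(S.filter P₁) * #G ≤ C₁ * #G ^ n * #G := by
      refine Finset.card_mul_card_le_of_head G _
        (fun c hc => (hS c (Finset.mem_of_mem_filter c hc)).1 0) fun d _ S' hS' => ?_
      refine hC₁ (fun o => o.elim (r d) t) G S' fun c hc => ?_
      obtain ⟨hcS, hcP⟩ := Finset.mem_filter.1 (hS' c hc)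
      refine ⟨fun i => (hS _ hcS).1 i.succ, ?_⟩
      simp only [Set.mem_preimage, hf]
      simpa [P₁, Y] using hcP
    have h₂ : #(S.filter P₂) * #G ≤ C₂ * #G ^ n * #G := by
      refine Finset.card_mul_card_le_of_head G _
        (fun c hc => (hS c (Finset.mem_of_mem_filter c hc)).1 0) fun d _ S' hS' => ?_
      refine hC₂ (fun o => o.elim (r d) t) G S' fun c hc => ?_
      obtain ⟨hcS, hcP⟩ := Finset.mem_filter.1 (hS' c hc)
      refine ⟨fun i => (hS _ hcS).1 i.succ, ?_⟩
      simpa [P₂, Y, hr] using hcP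
    have h₃ : #(S.filter P₃) ≤ K * #G ^ n := by
      refine Finset.card_le_of_tail G _
        (fun c hc => (hS c (Finset.mem_of_mem_filter c hc)).1) fun c S' hS' => ?_
      refine E.card_le_of_splitsClass (Y := {x | (Fin.cons x fun i => r (c i) :
        Fin (n + 1) → M) ∈ Y}) (fun a ha h => ?_) S' fun d hd => ?_
      · refine hK (Sum.elim t fun i => r (c i)) a ha fun i hi => ?_
        simp only [Set.mem_preimage, hg]
        exact h i hi
      · refine (Finset.mem_filter.1 (hS' d hd)).2 (fun i => r (c i)) ?_
        ext i
        simp [ConvexEquiv.proj, hr]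
    calc #S * #G ≤ (#(S.filter P₁) + #(S.filter P₂) + #(S.filter P₃)) * #G := by
          gcongr
          refine (Finset.card_le_card hcover).trans ((Finset.card_union_le _ _).trans ?_)
          gcongr
          exact Finset.card_union_le _ _
      _ ≤ C₁ * #G ^ n * #G + C₂ * #G ^ n * #G + K * #G ^ n * #G := by
          rw [add_mul, add_mul]
          gcongr
      _ = (C₁ + C₂ + K) * #G ^ (n + 1) := by ring

/-- A definable set does not split all the tuples of classes in an open box. -/
theorem IsWeaklyOMinimalTheory.not_containsBox_splits
    (hT : IsWeaklyOMinimalTheory.{u, v, w} T)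
    {M : Type w} [LinearOrder M] [L.Structure M] [L.OrderedStructure M] [M ⊨ T]
    {A : Set M} {E : ConvexEquiv M} (hE : A.Definable₂ L E.graph) {n : ℕ}
    {Y : Set (Fin n → M)} (hY : A.Definable L Y) :
    ¬ ContainsBox {c | E.Splits Y c} := by
  classical
  rintro ⟨J, hJ, hsub⟩
  obtain ⟨C, hC⟩ := hT.exists_card_splits_bound hE n
    (hY.preimage_comp (Sum.inr : Fin n → Empty ⊕ Fin n))
  have hC' : ∀ (G : Finset E.Quot) (S : Finset (Fin n → E.Quot)),
      (∀ c ∈ S, (∀ i, c i ∈ G) ∧ E.Splits Y c) → #S * #G ≤ C * #G ^ n := fun G S hS =>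
    hC Empty.elim G S hS
  cases n with
  | zero =>
    obtain ⟨⟨x, hx, -⟩, y, hy, -⟩ := hsub (fun i _ => i.elim0 : (fun i => i.elim0) ∈ Set.univ.pi J)
    exact hy (Subsingleton.elim x y ▸ hx)
  | succ m =>
    -- With `N` classes per side, the bound gives `N^(m+1) ≤ C ((m+1) N)^m`, that is `N ≤ C
    -- (m+1)^m`, which this `N` violates.
    let N := C * (m + 1) ^ m + 1
    choose G hGJ hGN using fun i => (hJ i).2.exists_subset_card_eq N
    let H := Finset.univ.biUnion G
    have hH : #H ≤ (m + 1) * N := by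
      simpa using Finset.card_biUnion_le_card_mul Finset.univ G N fun i _ => (hGN i).le
    have hHpos : 0 < #H := by
      have : G 0 ⊆ H := Finset.subset_biUnion_of_mem G (Finset.mem_univ 0)
      have := Finset.card_le_card this
      rw [hGN] at this
      omega
    have key := hC' H (Fintype.piFinset G) fun c hc => by
      rw [Fintype.mem_piFinset] at hc
      exact ⟨fun i => Finset.mem_biUnion.2 ⟨i, Finset.mem_univ i, hc i⟩,
        hsub fun i _ => hGJ i (hc i)⟩
    rw [Fintype.card_piFinset, Finset.prod_congr rfl fun i _ => hGN i, Finset.prod_const,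
      Finset.card_univ, Fintype.card_fin, pow_succ (#H), ← mul_assoc] at key
    have h1 : N ^ (m + 1) ≤ C * ((m + 1) * N) ^ m :=
      (Nat.le_of_mul_le_mul_right key hHpos).trans (by gcongr)
    rw [mul_pow, ← mul_assoc, pow_succ, mul_comm] at h1
    have h2 := Nat.le_of_mul_le_mul_right h1 (by positivity)
    omega

end Main

/-! ### Dimension and open boxes -/

section Dimension

variable {Q : Type w} [LinearOrder Q] {n : ℕ} {S : Set (Fin n → Q)}

theorem containsBox_image_univ_iff :
    ContainsBox ((fun (x : Fin n → Q) (i : (Finset.univ : Finset (Fin n))) => x i) '' S) ↔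
      ContainsBox S := by
  constructor
  · rintro ⟨J, hJ, hsub⟩
    refine ⟨fun i => J ⟨i, Finset.mem_univ i⟩, fun i => hJ _, fun x hx => ?_⟩
    obtain ⟨y, hy, hyx⟩ := hsub (show (fun i : (Finset.univ : Finset (Fin n)) => x i) ∈
      Set.univ.pi J from fun i _ => hx i trivial)
    have : y = x := funext fun i => congrFun hyx ⟨i, Finset.mem_univ i⟩
    exact this ▸ hy
  · rintro ⟨J, hJ, hsub⟩
    refine ⟨fun i => J i, fun i => hJ _, fun x hx => ?_⟩
    exact ⟨fun i => x ⟨i, Finset.mem_univ i⟩, hsub fun i _ => hx ⟨i, Finset.mem_univ i⟩ trivial, rfl⟩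

/-- Only the full set of coordinates has `n` elements. For `n = 0` the only box is the one-point
space, and both sides say that `S` is empty. -/
theorem orderDim_lt_iff : orderDim S < n ↔ ¬ ContainsBox S := by
  classical
  rw [orderDim, Finset.sup_lt_iff (show (⊥ : WithBot ℕ) < (n : WithBot ℕ) from WithBot.bot_lt_coe n)]
  constructor
  · intro h hbox
    have := h Finset.univ (Finset.mem_filter.2
      ⟨Finset.mem_univ _, containsBox_image_univ_iff.2 hbox⟩)
    simp at this
  · intro h s hs
    rcases eq_or_ne s Finset.univ with rfl | hne
    · exact absurd (containsBox_image_univ_iff.1 (Finset.mem_filter.1 hs).2) h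
    · have := (Finset.card_lt_iff_ne_univ s).2 hne
      exact_mod_cast this.trans_eq (Fintype.card_fin n)

theorem containsBox_univ [Infinite Q] : ContainsBox (Set.univ : Set (Fin n → Q)) :=
  ⟨fun _ => Set.univ, fun _ => ⟨Set.ordConnected_univ, Set.infinite_univ⟩, Set.subset_univ _⟩

/-- Every member of a generic type contains an open box. -/
theorem IsGenericIn.containsBox [Infinite Q] {p : Set (Set (Fin n → Q))}
    (hp : IsGenericIn p Set.univ) {D : Set (Fin n → Q)} (hD : D ∈ p) : ContainsBox D := by
  by_contra h
  exact orderDim_lt_iff.1 ((hp.2.2 ⟨D, hD, rfl⟩).trans_lt (orderDim_lt_iff.2 h)) containsBox_univ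

end Dimension

/-! ### Pulling back complete types -/

section Types

variable {X X' : Type w} {𝒟 p : Set (Set X)} {𝒟' : Set (Set X')}

theorem entails_pullbackType_of_preimage_subset (f : X' → X) {D : Set X} (hD : D ∈ p) {Y : Set X'}
    (h : f ⁻¹' D ⊆ Y) : Entails (pullbackType f p) Y := by
  classical
  exact ⟨{f ⁻¹' D}, by simpa using ⟨D, hD, rfl⟩, by simpa using h⟩

/-- The consequences of the pullback of a complete type along a surjection are finitely
satisfiable. -/
theorem IsCompleteType.consequences_finitely_satisfiable (hp : IsCompleteType 𝒟 p) {f : X' → X}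
    (hf : f.Surjective) (F : Finset (Set X')) (hF : ↑F ⊆ consequences 𝒟' (pullbackType f p)) :
    (⋂₀ (F : Set (Set X'))).Nonempty := by
  classical
  choose! H hH hHY using fun Y (hY : Y ∈ F) => (hF hY).2
  choose! g hg hgZ using fun Z (hZ : Z ∈ pullbackType f p) => hZ
  -- Finitely many consequences use finitely many members of `p`; a common point of these lifts
  -- along `f`.
  obtain ⟨c, hc⟩ := hp.finitely_satisfiable ((F.biUnion H).image g) (by
    intro D hD
    simp only [Finset.coe_image, Set.mem_image, Finset.mem_coe, Finset.mem_biUnion] at hD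
    obtain ⟨Z, ⟨Y, hY, hZ⟩, rfl⟩ := hD
    exact hg Z (hH Y hY hZ))
  obtain ⟨x, rfl⟩ := hf c
  refine ⟨x, fun Y hY => hHY Y hY fun Z hZ => ?_⟩
  rw [← hgZ Z (hH Y hY hZ)]
  exact hc (g Z) (Finset.mem_image_of_mem g (Finset.mem_biUnion.2 ⟨Y, hY, hZ⟩))

end Types

/-! ### The two claims -/

theorem mainTheorem7 {L : FirstOrder.Language.{u, v}} [L.IsOrdered] (T : L.Theory)
    (hT : IsWeaklyOMinimalTheory.{u, v, w} T)
    (M : Type w) [LinearOrder M] [L.Structure M] [L.OrderedStructure M] [M ⊨ T]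
    (A : Set M) (E : ConvexEquiv M) (hE : A.Definable₂ L E.graph) (n : ℕ) :
    (∀ (I : Fin n → Set M) (X : Set (Fin n → M)),
      (∀ j, (I j).OrdConnected ∧ (E.cls '' I j).Infinite) →
      (Set.univ : Set M).Definable L X →
      X ⊆ Set.univ.pi I →
      E.proj n '' X = E.proj n '' Set.univ.pi I →
      orderDim (E.proj n '' (Set.univ.pi I \ X)) < n) ∧
    (Infinite E.Quot →
      ∀ p : Set (Set (Fin n → E.Quot)),
        IsCompleteType (E.definableQuotSets L A n) p →
        IsGenericIn p Set.univ →
        IsCompleteType (definableSets L A n)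
          (consequences (definableSets L A n) (pullbackType (E.proj n) p))) := by
  constructor
  · intro I X _ hX _ hπ
    rw [orderDim_lt_iff]
    rintro ⟨J, hJ, hsub⟩
    -- `X` may use any parameters, so `E` is also regarded as definable over all of `M`.
    refine hT.not_containsBox_splits (Set.Definable.mono hE (Set.subset_univ A)) hX
      ⟨J, hJ, fun c hc => ?_⟩
    obtain ⟨y, ⟨hyI, hyX⟩, hy⟩ := hsub hc
    obtain ⟨x, hx, hxc⟩ : c ∈ E.proj n '' X := hπ ▸ ⟨y, hyI, hy⟩
    exact ⟨⟨x, hx, hxc⟩, y, hyX, hy⟩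
  · intro _ p hp hgen
    have hsurj : (E.proj n).Surjective := fun c => by
      choose x hx using fun i => E.exists_cls (c i)
      exact ⟨x, funext hx⟩
    refine ⟨fun Y hY => hY.1, hp.consequences_finitely_satisfiable hsurj, fun Y hY => ?_⟩
    have hY' : A.Definable L Yᶜ := Set.Definable.compl hY
    have hsat : ∀ {Z : Set (Fin n → M)}, A.Definable L Z →
        E.proj n '' Z ∈ E.definableQuotSets L A n :=
      fun hZ => ConvexEquiv.definable_saturation hE hZ
    rcases hp.complete _ (hsat hY) with h | h
    · rcases hp.complete _ (hsat hY') with h' | h'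
      · have hsplit : E.proj n '' Y ∩ E.proj n '' Yᶜ ∈ p := by
          rcases hp.complete (E.proj n '' Y ∩ E.proj n '' Yᶜ)
            (Set.Definable.inter (hsat hY) (hsat hY')) with h'' | h''
          · exact h''
          · exfalso
            obtain ⟨c, hc⟩ := hp.finitely_satisfiable
              (by classical exact {E.proj n '' Y, E.proj n '' Yᶜ,
                (E.proj n '' Y ∩ E.proj n '' Yᶜ)ᶜ})
              (by simp [Set.insert_subset_iff, h, h', h''])
            simp at hc
            grind
        exact absurd (hgen.containsBox hsplit) (hT.not_containsBox_splits hE hY)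
      · refine .inl ⟨hY, entails_pullbackType_of_preimage_subset _ h' fun x hx => ?_⟩
        by_contra hxY
        exact hx ⟨x, hxY, rfl⟩
    · refine .inr ⟨hY', entails_pullbackType_of_preimage_subset _ h fun x hx hxY => ?_⟩
      exact hx ⟨x, hxY, rfl⟩
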